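/- Work in max algebra over $\mathbb{R}_+=[0,\infty)$: the product of $A,B\in\mathbb{R}_+^{n\times n}$, $n\ge 1$, is $(A\otimes B)_{ij}=\max_k a_{ik}b_{kj}$, and $A$, $B$ commute if $A\otimes B=B\otimes A$. The associated digraph of $A$ has node set $\{1,\dots,n\}$ and an edge $(i,j)$ whenever $a_{ij}>0$. Call $A$ irreducible if for all $i,j$ (including $i=j$) this digraph contains a path of positive length from $i$ to $j$; that is, the digraph is strongly connected and $A$ is not the $1\times1$ zero matrix. Let $$\lambda(A)=\max_{1\le k\le n}\ \max_{i_1,\dots,i_k}\,(a_{i_1i_2}a_{i_2i_3}\cdots a_{i_ki_1})^{1/k}$$ be the maximal cycle geometric mean of $A$. A critical cycle of $A$ is a cycle of the associated digraph whose geometric mean equals $\lambda(A)$, and the critical digraph $\mathrm{crit}(A)$ consists of all nodes and edges lying on critical cycles; its nodes are called eigennodes (critical nodes) of $A$. Theorem. Let $A,B\in\mathbb{R}_+^{n\times n}$ be irreducible matrices that commute in max algebra. Then there exists a cycle $c_1$ in $\mathrm{crit}(A)$ such that every node of $c_1$ belongs to a strongly connected component of $\mathrm{crit}(B)$, and there exists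 a cycle $c_2$ in $\mathrm{crit}(B)$ such that every node of $c_2$ belongs to a strongly connected component of $\mathrm{crit}(A)$. In particular, $A$ and $B$ have a common eigennode. -/

import Mathlib

open scoped NNReal

namespace MaxAlgebra

/-- A digraph `(N, E)` with node set `N` inside an ambient type `V`, loops allowed. -/
structure NodeDigraph (V : Type*) where
  /-- the node set -/
  nodes : Set V
  /-- the edge relation -/
  Edge : V → V → Prop
  /-- edges join nodes of the digraph -/
  edge_mem : ∀ {i j : V}, Edge i j → i ∈ nodes ∧ j ∈ nodes

namespace NodeDigraph

variable {V : Type*}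

/-- The sequence `c 0, …, c k` of pairwise distinct nodes is a cycle (of length `k + 1`) of `G`.
The addition `t + 1` in `Fin (k + 1)` is cyclic, so the last edge goes from `c k` to `c 0`;
for `k = 0` the cycle is a loop. -/
def IsCycle (G : NodeDigraph V) {k : ℕ} (c : Fin (k + 1) → V) : Prop :=
  Function.Injective c ∧ ∀ t, G.Edge (c t) (c (t + 1))

/-- `j` can be reached from `i` by a (possibly empty) path of `G`. -/
def Reaches (G : NodeDigraph V) (i j : V) : Prop :=
  Relation.ReflTransGen G.Edge i j

/-- `S` is the node set of a strongly connected component of `G`. -/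
def IsStrongComponent (G : NodeDigraph V) (S : Set V) : Prop :=
  ∃ i ∈ G.nodes, S = {j | j ∈ G.nodes ∧ G.Reaches i j ∧ G.Reaches j i}

end NodeDigraph

variable {n : ℕ}

/-- The max-algebra product `A ⊗ B`, with entries `max_k a_{ik} b_{kj}`. -/
noncomputable def maxMul (A B : Matrix (Fin n) (Fin n) ℝ≥0) : Matrix (Fin n) (Fin n) ℝ≥0 :=
  fun i j => Finset.univ.sup fun k => A i k * B k j

/-- `A` and `B` commute in max algebra. -/
def MaxCommute (A B : Matrix (Fin n) (Fin n) ℝ≥0) : Prop :=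
  maxMul A B = maxMul B A

/-- `A` is irreducible: any two nodes are joined by a path of positive length in the digraph
of the positive entries of `A`. -/
def IsIrreducible (A : Matrix (Fin n) (Fin n) ℝ≥0) : Prop :=
  (A.map ((↑) : ℝ≥0 → ℝ)).IsIrreducible

/-- The associated digraph of `A`: its nodes are all indices, and `(i, j)` is an edge whenever
`a_{ij} > 0`. -/
def assocDigraph (A : Matrix (Fin n) (Fin n) ℝ≥0) : NodeDigraph (Fin n) where
  nodes := Set.univ
  Edge i j := 0 < A i j
  edge_mem _ := ⟨Set.mem_univ _, Set.mem_univ _⟩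

/-- The geometric mean `(a_{i_1 i_2} ⋯ a_{i_m i_1})^{1/m}` of the entries of `A` along a closed
sequence of `m = k + 1` indices. -/
noncomputable def cycleMean (A : Matrix (Fin n) (Fin n) ℝ≥0) {k : ℕ}
    (c : Fin (k + 1) → Fin n) : ℝ≥0 :=
  (∏ t, A (c t) (c (t + 1))) ^ (1 / ((k : ℝ) + 1))

/-- The Perron root `λ(A)` as the maximal cycle geometric mean: the maximum of `cycleMean A c` over
all closed sequences of at most `n` indices. -/
noncomputable def perronRoot (A : Matrix (Fin n) (Fin n) ℝ≥0) : ℝ≥0 :=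
  (Finset.range n).sup fun k => Finset.univ.sup fun c : Fin (k + 1) → Fin n => cycleMean A c

/-- A critical cycle of `A`: a cycle of the associated digraph whose geometric mean is `λ(A)`. -/
def IsCriticalCycle (A : Matrix (Fin n) (Fin n) ℝ≥0) {k : ℕ} (c : Fin (k + 1) → Fin n) : Prop :=
  (assocDigraph A).IsCycle c ∧ cycleMean A c = perronRoot A

/-- The critical digraph of `A`: all nodes and edges on critical cycles. Its nodes are the
critical nodes, or eigennodes, of `A`. -/
def crit (A : Matrix (Fin n) (Fin n) ℝ≥0) : NodeDigraph (Fin n) where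
  nodes := {i | ∃ (k : ℕ) (c : Fin (k + 1) → Fin n), IsCriticalCycle A c ∧ ∃ t, c t = i}
  Edge i j := ∃ (k : ℕ) (c : Fin (k + 1) → Fin n),
    IsCriticalCycle A c ∧ ∃ t, c t = i ∧ c (t + 1) = j
  edge_mem := by
    rintro i j ⟨k, c, hc, t, hi, hj⟩
    exact ⟨⟨k, c, hc, t, hi⟩, ⟨k, c, hc, t + 1, hj⟩⟩

end MaxAlgebra

open Relation Filter Topology

/-! Irreducibility makes both Perron roots positive, so both matrices can be scaled to maximal cycle
mean one, preserving commutation. The scaled matrices share a positive eigenvector `w`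
(`exists_common_eigenvector`): Kleene stars produce a common positive subeigenvector, and iterating
one matrix, then the other, decreases it to a limit that stays positive. Call an edge saturated if
it attains the maximum defining the eigenvector equation at its tail. Every node has a saturated
out-edge, and saturated cycles are critical because the entries of `w` cancel around them.
Commutation replaces a `B`-saturated edge followed by an `A`-saturated one by an `A`-edge followed
by a `B`-edge with the same ends (`Saturated.comm`). Finite combinatorics (`exists_cycle_of_comm`)
then gives an `A`-saturated cycle whose nodes all lie on closed `B`-saturated walks; exchanging the
matrices gives the other cycle. -/

namespace MaxAlgebra

/-! ### Cycles in finite digraphs and commuting relations -/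

section Digraph

variable {V : Type*}

/-- Along a closed walk of length `k + 1`, the cyclic successor in `Fin (k + 1)` is the successor
in the walk. -/
theorem closedWalk_apply_add_one {x : ℕ → V} {k : ℕ} (hx : x (k + 1) = x 0) (t : Fin (k + 1)) :
    x ((t + 1 : Fin (k + 1)) : ℕ) = x ((t : ℕ) + 1) := by
  rw [Fin.val_add_one]
  split_ifs with h
  · rw [h, Fin.val_last, hx]
  · rfl

theorem exists_walk_of_transGen {R : V → V → Prop} {i j : V} (h : TransGen R i j) :
    ∃ (k : ℕ) (x : ℕ → V), x 0 = i ∧ x (k + 1) = j ∧ ∀ t < k + 1, R (x t) (x (t + 1)) := by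
  induction h using TransGen.head_induction_on with
  | @single a h =>
    refine ⟨0, fun t => if t = 0 then a else j, by simp, by simp, ?_⟩
    intro t ht
    obtain rfl : t = 0 := by omega
    simpa using h
  | @head a c hac _ ih =>
    obtain ⟨k, x, h0, hk, hR⟩ := ih
    refine ⟨k + 1, fun t => if t = 0 then a else x (t - 1), by simp, by simpa using hk, ?_⟩
    intro t ht
    rcases t with _ | t
    · simpa [h0] using hac
    · simpa using hR t (by omega)

/-- A node on a closed walk lies on a cycle. -/
theorem exists_cycle_of_transGen {R : V → V → Prop} {i : V} (h : TransGen R i i) :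
    ∃ (k : ℕ) (c : Fin (k + 1) → V), Function.Injective c ∧ c 0 = i ∧ ∀ t, R (c t) (c (t + 1)) := by
  classical
  have hex : ∃ k, ∃ x : ℕ → V, x 0 = i ∧ x (k + 1) = i ∧ ∀ t < k + 1, R (x t) (x (t + 1)) :=
    exists_walk_of_transGen h
  obtain ⟨x, h0, hk, hR⟩ := Nat.find_spec hex
  set k := Nat.find hex
  have hne : ∀ p q, p < q → q < k + 1 → x p ≠ x q := by
    intro p q hpq hq heq
    -- A repeated node would let the segment from `p` to `q` be cut out, contradicting minimality of
    -- the closed walk.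
    refine Nat.find_min hex (m := k - (q - p)) (by omega)
      ⟨fun t => if t ≤ p then x t else x (t + (q - p)), by simp [h0], ?_, ?_⟩
    · have h1 : ¬ k - (q - p) + 1 ≤ p := by omega
      have h2 : k - (q - p) + 1 + (q - p) = k + 1 := by omega
      simp only [h1, if_false, h2, hk]
    · intro t ht
      rcases lt_trichotomy t p with h1 | h1 | h1
      · have h2 : t + 1 ≤ p := h1
        simpa only [h1.le, h2, if_true] using hR t (by omega)
      · subst h1
        have h2 : ¬ t + 1 ≤ t := by omega
        have h3 : t + 1 + (q - t) = q + 1 := by omega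
        simpa only [le_refl, h2, if_true, if_false, h3, heq] using hR q hq
      · have h2 : ¬ t ≤ p := by omega
        have h3 : ¬ t + 1 ≤ p := by omega
        have h4 : t + 1 + (q - p) = t + (q - p) + 1 := by omega
        simpa only [h2, h3, if_false, h4] using hR (t + (q - p)) (by omega)
  refine ⟨k, fun t => x t, ?_, h0, ?_⟩
  · intro s t hst
    rcases lt_trichotomy (s : ℕ) t with h1 | h1 | h1
    · exact absurd hst (hne _ _ h1 t.2)
    · exact Fin.ext h1
    · exact absurd hst.symm (hne _ _ h1 s.2)
  · intro t
    change R (x t) (x _)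
    rw [closedWalk_apply_add_one (x := x) (by rw [hk, h0])]
    exact hR t t.2

/-- In a finite digraph, a nonempty set of nodes each of which has a successor in the set contains
a node on a closed walk. -/
theorem exists_transGen_self [Finite V] {R : V → V → Prop} {S : Set V} (hS : S.Nonempty)
    (h : ∀ i ∈ S, ∃ j ∈ S, R i j) : ∃ i ∈ S, TransGen R i i := by
  -- Reversed, so that an `r`-minimal element is one with no successor in `S`.
  let r : S → S → Prop := fun i j => TransGen R (j : V) i
  have : IsTrans S r := ⟨fun _ _ _ h1 h2 => TransGen.trans h2 h1⟩
  by_contra! hcon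
  have : Std.Irrefl r := ⟨fun i => hcon i i.2⟩
  obtain ⟨i, hi⟩ := hS
  obtain ⟨m, -, hm⟩ := (Finite.wellFounded_of_trans_of_irrefl r).has_min Set.univ ⟨⟨i, hi⟩, trivial⟩
  obtain ⟨j, hj, hR⟩ := h m m.2
  exact hm ⟨j, hj⟩ trivial (TransGen.single hR)

/-- If `P` and `Q` are commuting serial relations on a finite type, then there is a cycle of `P`
all of whose nodes lie on closed walks of `Q`. -/
theorem exists_cycle_of_comm [Finite V] [Nonempty V] {P Q : V → V → Prop}
    (hP : ∀ i, ∃ j, P i j) (hQ : ∀ i, ∃ j, Q i j)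
    (hQP : ∀ i j k, Q i j → P j k → ∃ l, P i l ∧ Q l k) :
    ∃ (k : ℕ) (c : Fin (k + 1) → V), Function.Injective c ∧ (∀ t, P (c t) (c (t + 1))) ∧
      ∀ t, TransGen Q (c t) (c t) := by
  have lift : ∀ i j, TransGen Q i j → ∀ k, P j k → ∃ l, P i l ∧ TransGen Q l k := by
    intro i j h
    induction h with
    | single h =>
      intro k hk
      obtain ⟨l, h1, h2⟩ := hQP _ _ _ h hk
      exact ⟨l, h1, .single h2⟩
    | tail _ h ih =>
      intro k hk
      obtain ⟨l, h1, h2⟩ := hQP _ _ _ h hk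
      obtain ⟨m, h3, h4⟩ := ih l h1
      exact ⟨m, h3, h4.tail h2⟩
  have succ : ∀ i, TransGen Q i i → ∃ j, P i j ∧ TransGen Q j j := by
    intro i hi
    -- Lifting the closed `Q`-walk at `i` gives every `P`-successor of `i` a `Q`-predecessor (along
    -- a walk) that is again a `P`-successor of `i`. Finiteness closes this backward chain up.
    obtain ⟨j, hj, hjj⟩ := exists_transGen_self (R := fun a b => TransGen Q b a)
      (S := {j | P i j}) (hP i) (fun j hj => lift i i hi j hj)
    have hsub : ∀ a b, TransGen (fun a b => TransGen Q b a) a b → TransGen Q b a := by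
      intro a b h
      induction h with
      | single h => exact h
      | tail _ h ih => exact h.trans ih
    exact ⟨j, hj, hsub _ _ hjj⟩
  obtain ⟨i, -, hi⟩ := exists_transGen_self (R := Q) Set.univ_nonempty
    (fun i _ => (hQ i).imp fun _ h => ⟨trivial, h⟩)
  -- The condition on `a` is built into the relation so that it survives at every node of the
  -- extracted cycle.
  obtain ⟨j, -, hj⟩ := exists_transGen_self (S := {i | TransGen Q i i})
    (R := fun a b => P a b ∧ TransGen Q a a) ⟨i, hi⟩
    (fun a ha => (succ a ha).imp fun _ h => ⟨h.2, h.1, ha⟩)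
  obtain ⟨k, c, hc, -, hcP⟩ := exists_cycle_of_transGen hj
  exact ⟨k, c, hc, fun t => (hcP t).1, fun t => (hcP t).2⟩

theorem NodeDigraph.exists_isStrongComponent {G : NodeDigraph V} {i : V} (hi : i ∈ G.nodes) :
    ∃ S, G.IsStrongComponent S ∧ i ∈ S :=
  ⟨_, ⟨i, hi, rfl⟩, hi, .refl, .refl⟩

end Digraph

/-! ### Max-linear maps, definite matrices and Kleene stars -/

variable {n : ℕ}

theorem prod_add_one {k : ℕ} (f : Fin (k + 1) → ℝ≥0) : ∏ t, f (t + 1) = ∏ t, f t :=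
  Equiv.prod_comp (Equiv.addRight (1 : Fin (k + 1))) f

/-- The max-algebra matrix-vector product. -/
noncomputable def maxMulVec (A : Matrix (Fin n) (Fin n) ℝ≥0) (x : Fin n → ℝ≥0) : Fin n → ℝ≥0 :=
  fun i => Finset.univ.sup fun j => A i j * x j

theorem mul_le_maxMulVec (A : Matrix (Fin n) (Fin n) ℝ≥0) (x : Fin n → ℝ≥0) (i j : Fin n) :
    A i j * x j ≤ maxMulVec A x i :=
  Finset.le_sup (f := fun j => A i j * x j) (Finset.mem_univ j)

theorem exists_maxMulVec_eq (A : Matrix (Fin n) (Fin n) ℝ≥0) (x : Fin n → ℝ≥0) (i : Fin n) :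
    ∃ j, maxMulVec A x i = A i j * x j := by
  obtain ⟨j, -, hj⟩ := Finset.exists_mem_eq_sup Finset.univ ⟨i, Finset.mem_univ i⟩
    fun j => A i j * x j
  exact ⟨j, hj⟩

theorem maxMulVec_mono (A : Matrix (Fin n) (Fin n) ℝ≥0) : Monotone (maxMulVec A) :=
  fun _ _ h i => Finset.sup_mono_fun fun j _ => mul_le_mul_right (h j) (A i j)

theorem continuous_maxMulVec (A : Matrix (Fin n) (Fin n) ℝ≥0) : Continuous (maxMulVec A) :=
  continuous_pi fun i => Continuous.finset_sup_apply fun j _ => by fun_prop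

theorem maxMulVec_maxMulVec (A B : Matrix (Fin n) (Fin n) ℝ≥0) (x : Fin n → ℝ≥0) :
    maxMulVec A (maxMulVec B x) = maxMulVec (maxMul A B) x := by
  funext i
  simp only [maxMulVec, maxMul, NNReal.mul_finset_sup, NNReal.finset_sup_mul, mul_assoc]
  exact Finset.sup_comm _ _ _

theorem MaxCommute.commute_maxMulVec {A B : Matrix (Fin n) (Fin n) ℝ≥0} (h : MaxCommute A B) :
    Function.Commute (maxMulVec A) (maxMulVec B) := fun x => by
  rw [maxMulVec_maxMulVec, maxMulVec_maxMulVec, h]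

/-- The matrix `A` has maximal cycle mean one. -/
def IsDefinite (A : Matrix (Fin n) (Fin n) ℝ≥0) : Prop :=
  (∀ k < n, ∀ c : Fin (k + 1) → Fin n, ∏ t, A (c t) (c (t + 1)) ≤ 1) ∧
    ∃ (k : ℕ) (c : Fin (k + 1) → Fin n), ∏ t, A (c t) (c (t + 1)) = 1

theorem walk_le_iterate (A : Matrix (Fin n) (Fin n) ℝ≥0) (w : Fin n → ℝ≥0) (x : ℕ → Fin n) :
    ∀ k, (∏ t ∈ Finset.range k, A (x t) (x (t + 1))) * w (x k) ≤ (maxMulVec A)^[k] w (x 0) := by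
  intro k
  induction k generalizing x with
  | zero => simp
  | succ k ih =>
    rw [Function.iterate_succ_apply', Finset.prod_range_succ', mul_comm (Finset.prod _ _),
      mul_assoc]
    exact (mul_le_mul_right (ih fun t => x (t + 1)) _).trans (mul_le_maxMulVec _ _ _ _)

theorem exists_walk_iterate_eq (A : Matrix (Fin n) (Fin n) ℝ≥0) (w : Fin n → ℝ≥0) (k : ℕ)
    (i : Fin n) : ∃ x : ℕ → Fin n, x 0 = i ∧
      (maxMulVec A)^[k] w i = (∏ t ∈ Finset.range k, A (x t) (x (t + 1))) * w (x k) := by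
  induction k generalizing i with
  | zero => exact ⟨fun _ => i, rfl, by simp⟩
  | succ k ih =>
    rw [Function.iterate_succ_apply']
    obtain ⟨j, hj⟩ := exists_maxMulVec_eq A ((maxMulVec A)^[k] w) i
    obtain ⟨x, h0, hx⟩ := ih j
    refine ⟨fun t => if t = 0 then i else x (t - 1), by simp, ?_⟩
    rw [hj, hx, Finset.prod_range_succ']
    simp [h0]
    ring

/-- Deleting a cycle from a walk of length `n` does not decrease its weight. -/
theorem IsDefinite.exists_iterate_le {A : Matrix (Fin n) (Fin n) ℝ≥0} (hA : IsDefinite A)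
    (w : Fin n → ℝ≥0) (i : Fin n) : ∃ k < n, (maxMulVec A)^[n] w i ≤ (maxMulVec A)^[k] w i := by
  obtain ⟨x, h0, hx⟩ := exists_walk_iterate_eq A w n i
  obtain ⟨p, q, hpq, hq, heq⟩ : ∃ p q, p < q ∧ q ≤ n ∧ x p = x q := by
    obtain ⟨a, b, hab, h⟩ := Fintype.exists_ne_map_eq_of_card_lt
      (fun t : Fin (n + 1) => x t) (by simp)
    rcases lt_or_gt_of_ne hab with h1 | h1
    · exact ⟨a, b, h1, by omega, h⟩
    · exact ⟨b, a, h1, by omega, h.symm⟩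
  obtain ⟨m, rfl⟩ : ∃ m, q = p + (m + 1) := ⟨q - p - 1, by omega⟩
  obtain ⟨r, hr⟩ : ∃ r, n = p + (m + 1) + r := ⟨n - (p + (m + 1)), by omega⟩
  refine ⟨p + r, by omega, ?_⟩
  have hcyc : ∏ t ∈ Finset.range (m + 1), A (x (p + t)) (x (p + t + 1)) ≤ 1 := by
    have := hA.1 m (by omega) fun t => x (p + t)
    rw [← Fin.prod_univ_eq_prod_range (fun t => A (x (p + t)) (x (p + t + 1)))]
    convert this using 3 with t
    exact (closedWalk_apply_add_one (x := fun t => x (p + t)) (by simpa using heq.symm) t).symm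
  have h1 := walk_le_iterate A w (fun t => x (p + (m + 1) + t)) r
  have h2 := walk_le_iterate A ((maxMulVec A)^[r] w) x p
  rw [← Function.iterate_add_apply, h0] at h2
  refine le_trans ?_ h2
  have hx' : (maxMulVec A)^[n] w i = (∏ t ∈ Finset.range (p + (m + 1) + r),
      A (x t) (x (t + 1))) * w (x (p + (m + 1) + r)) := by rw [← hr, hx]
  rw [hx', Finset.prod_range_add, Finset.prod_range_add, mul_assoc, mul_assoc]
  refine mul_le_mul_right ?_ _
  rw [heq]
  exact (mul_le_mul_left hcyc _).trans ((one_mul _).trans_le h1)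

/-- The vector `A* ⊗ w`, where `A*` is the Kleene star of a definite matrix `A`. -/
noncomputable def starMulVec (A : Matrix (Fin n) (Fin n) ℝ≥0) (w : Fin n → ℝ≥0) : Fin n → ℝ≥0 :=
  fun i => (Finset.range n).sup fun k => (maxMulVec A)^[k] w i

theorem iterate_le_starMulVec (A : Matrix (Fin n) (Fin n) ℝ≥0) (w : Fin n → ℝ≥0) {k : ℕ}
    (hk : k < n) (i : Fin n) : (maxMulVec A)^[k] w i ≤ starMulVec A w i :=
  Finset.le_sup (f := fun k => (maxMulVec A)^[k] w i) (Finset.mem_range.2 hk)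

theorem le_starMulVec (A : Matrix (Fin n) (Fin n) ℝ≥0) (w : Fin n → ℝ≥0) : w ≤ starMulVec A w :=
  fun i => iterate_le_starMulVec A w (Nat.zero_lt_of_lt i.2) i

theorem maxMulVec_starMulVec (A B : Matrix (Fin n) (Fin n) ℝ≥0) (w : Fin n → ℝ≥0) (i : Fin n) :
    maxMulVec B (starMulVec A w) i =
      (Finset.range n).sup fun k => maxMulVec B ((maxMulVec A)^[k] w) i := by
  simp only [maxMulVec, starMulVec, NNReal.mul_finset_sup]
  exact Finset.sup_comm _ _ _

theorem IsDefinite.maxMulVec_starMulVec_le {A : Matrix (Fin n) (Fin n) ℝ≥0} (hA : IsDefinite A)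
    (w : Fin n → ℝ≥0) : maxMulVec A (starMulVec A w) ≤ starMulVec A w := by
  intro i
  rw [maxMulVec_starMulVec]
  refine Finset.sup_le fun k hk => ?_
  rw [← Function.iterate_succ_apply' (maxMulVec A)]
  rcases Nat.lt_or_ge (k + 1) n with h | h
  · exact iterate_le_starMulVec A w h i
  · obtain ⟨l, hl, hle⟩ := hA.exists_iterate_le w i
    rw [show k.succ = n by have := Finset.mem_range.1 hk; omega]
    exact hle.trans (iterate_le_starMulVec A w hl i)

/-- Each iterate of `B` is monotone and commutes with `A`, hence preserves subeigenvectors of `A`;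
so does the maximum of the iterates. -/
theorem maxMulVec_starMulVec_le_of_commute {A B : Matrix (Fin n) (Fin n) ℝ≥0}
    (hAB : MaxCommute A B) {w : Fin n → ℝ≥0} (hw : maxMulVec A w ≤ w) :
    maxMulVec A (starMulVec B w) ≤ starMulVec B w := by
  intro i
  rw [maxMulVec_starMulVec]
  refine Finset.sup_mono_fun fun k _ => ?_
  rw [hAB.commute_maxMulVec.iterate_right k w]
  exact ((maxMulVec_mono B).iterate k) hw i

/-- Commuting definite matrices have a common positive subeigenvector. -/
theorem exists_common_subeigenvector {A B : Matrix (Fin n) (Fin n) ℝ≥0} (hAB : MaxCommute A B)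
    (hA : IsDefinite A) (hB : IsDefinite B) :
    ∃ u : Fin n → ℝ≥0, (∀ i, 0 < u i) ∧ maxMulVec A u ≤ u ∧ maxMulVec B u ≤ u :=
  ⟨starMulVec B (starMulVec A 1),
    fun i => zero_lt_one.trans_le ((le_starMulVec A 1 i).trans (le_starMulVec B _ i)),
    maxMulVec_starMulVec_le_of_commute hAB (hA.maxMulVec_starMulVec_le 1),
    hB.maxMulVec_starMulVec_le _⟩

/-! ### Limits of iterates and common eigenvectors -/

theorem antitone_iterate_maxMulVec {A : Matrix (Fin n) (Fin n) ℝ≥0} {u : Fin n → ℝ≥0}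
    (hu : maxMulVec A u ≤ u) : Antitone fun k => (maxMulVec A)^[k] u :=
  antitone_nat_of_succ_le fun k => by
    rw [Function.iterate_succ_apply]
    exact (maxMulVec_mono A).iterate k hu

theorem exists_tendsto_iterate {A : Matrix (Fin n) (Fin n) ℝ≥0} {u : Fin n → ℝ≥0}
    (hu : maxMulVec A u ≤ u) :
    ∃ v, Tendsto (fun k => (maxMulVec A)^[k] u) atTop (𝓝 v) :=
  ⟨fun i => ⨅ k, (maxMulVec A)^[k] u i, tendsto_pi_nhds.2 fun i =>
    tendsto_atTop_ciInf (fun _ _ h => antitone_iterate_maxMulVec hu h i) (OrderBot.bddBelow _)⟩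

/-- A positive subeigenvector of a definite matrix `A` is invariant under `A` on any
critical cycle. -/
theorem IsDefinite.exists_iterate_eq {A : Matrix (Fin n) (Fin n) ℝ≥0} (hA : IsDefinite A)
    {u : Fin n → ℝ≥0} (hpos : ∀ i, 0 < u i) (hu : maxMulVec A u ≤ u) :
    ∃ i, ∀ k, (maxMulVec A)^[k] u i = u i := by
  obtain ⟨m, c, hc⟩ := hA.2
  have hle : ∀ t, A (c t) (c (t + 1)) * u (c (t + 1)) ≤ u (c t) := fun t =>
    (mul_le_maxMulVec A u _ _).trans (hu _)
  have heq : ∀ t, A (c t) (c (t + 1)) * u (c (t + 1)) = u (c t) := by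
    -- Multiplying the inequalities around the cycle gives equality, since the entries of `A` have
    -- product one and those of `u` cancel; none can be strict.
    by_contra! hne
    obtain ⟨t, ht⟩ := hne
    have hApos : ∀ t, 0 < A (c t) (c (t + 1)) := fun t => pos_iff_ne_zero.2 fun h0 => by
      rw [Finset.prod_eq_zero (Finset.mem_univ t) h0] at hc
      exact zero_ne_one hc
    have hlt := Finset.prod_lt_prod (s := Finset.univ)
      (fun t _ => mul_pos (hApos t) (hpos (c (t + 1)))) (fun t _ => hle t)
      ⟨t, Finset.mem_univ t, lt_of_le_of_ne (hle t) ht⟩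
    rw [Finset.prod_mul_distrib, hc, one_mul,
      prod_add_one fun t => u (c t)] at hlt
    exact lt_irrefl _ hlt
  have key : ∀ k t, u (c t) ≤ (maxMulVec A)^[k] u (c t) := by
    intro k
    induction k with
    | zero => intro t; rfl
    | succ k ih =>
      intro t
      rw [Function.iterate_succ_apply', ← heq t]
      exact (mul_le_mul_right (ih (t + 1)) _).trans (mul_le_maxMulVec _ _ _ _)
  exact ⟨c 0, fun k => le_antisymm (antitone_iterate_maxMulVec hu (Nat.zero_le k) _) (key k 0)⟩

theorem IsIrreducible.transGen {A : Matrix (Fin n) (Fin n) ℝ≥0} (hA : IsIrreducible A)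
    (i j : Fin n) : TransGen (fun i j => 0 < A i j) i j := by
  let : Quiver (Fin n) := Matrix.toQuiver (A.map ((↑) : ℝ≥0 → ℝ))
  have key : ∀ {j : Fin n} (p : Quiver.Path i j), 0 < p.length →
      TransGen (fun i j => 0 < A i j) i j := by
    intro j p
    induction p with
    | nil => intro h; exact absurd h (lt_irrefl _)
    | @cons b c p e ih =>
      intro _
      have he : 0 < A b c := by exact_mod_cast e.down
      rcases Nat.eq_zero_or_pos p.length with h | h
      · obtain rfl := Quiver.Path.eq_of_length_zero p h
        exact .single he
      · exact (ih h).tail he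
  obtain ⟨p, hp⟩ := hA.connected i j
  exact key p hp

theorem eigenvector_pos {A : Matrix (Fin n) (Fin n) ℝ≥0}
    (hA : ∀ i j, TransGen (fun i j => 0 < A i j) i j) {v : Fin n → ℝ≥0}
    (hv : maxMulVec A v = v) {i : Fin n} (hi : 0 < v i) (j : Fin n) : 0 < v j := by
  induction hA j i using TransGen.head_induction_on with
  | single h => exact (mul_pos h hi).trans_le ((mul_le_maxMulVec A v _ _).trans_eq (congrFun hv _))
  | head h _ ih =>
    exact (mul_pos h ih).trans_le ((mul_le_maxMulVec A v _ _).trans_eq (congrFun hv _))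

/-- Commuting irreducible definite matrices have a common positive eigenvector. -/
theorem exists_common_eigenvector {A B : Matrix (Fin n) (Fin n) ℝ≥0} (hAB : MaxCommute A B)
    (hA : IsDefinite A) (hB : IsDefinite B)
    (hA' : ∀ i j, TransGen (fun i j => 0 < A i j) i j)
    (hB' : ∀ i j, TransGen (fun i j => 0 < B i j) i j) :
    ∃ w : Fin n → ℝ≥0, (∀ i, 0 < w i) ∧ maxMulVec A w = w ∧ maxMulVec B w = w := by
  obtain ⟨u, hu, hAu, hBu⟩ := exists_common_subeigenvector hAB hA hB
  have fixed : ∀ {C : Matrix (Fin n) (Fin n) ℝ≥0}, IsDefinite C →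
      (∀ i j, TransGen (fun i j => 0 < C i j) i j) → ∀ {u v : Fin n → ℝ≥0}, (∀ i, 0 < u i) →
      maxMulVec C u ≤ u → Tendsto (fun k => (maxMulVec C)^[k] u) atTop (𝓝 v) →
      maxMulVec C v = v ∧ ∀ i, 0 < v i := by
    intro C hC hC' u v hu hCu hv
    have hfix : maxMulVec C v = v :=
      isFixedPt_of_tendsto_iterate hv (continuous_maxMulVec C).continuousAt
    -- A coordinate on a critical cycle never decreases, so the limit is nonzero.
    obtain ⟨i, hi⟩ := hC.exists_iterate_eq hu hCu
    have hvi : v i = u i := tendsto_nhds_unique (tendsto_pi_nhds.1 hv i) (by simp [hi])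
    exact ⟨hfix, eigenvector_pos hC' hfix (hvi ▸ hu i)⟩
  obtain ⟨v, hv⟩ := exists_tendsto_iterate hAu
  obtain ⟨hAv, hvpos⟩ := fixed hA hA' hu hAu hv
  have hcomm := hAB.commute_maxMulVec
  have hBv : maxMulVec B v ≤ v := by
    refine le_of_tendsto_of_tendsto' (((continuous_maxMulVec B).tendsto v).comp hv) hv fun k => ?_
    change maxMulVec B ((maxMulVec A)^[k] u) ≤ _
    rw [hcomm.symm.iterate_right k u]
    exact (maxMulVec_mono A).iterate k hBu
  obtain ⟨w, hw⟩ := exists_tendsto_iterate hBv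
  obtain ⟨hBw, hwpos⟩ := fixed hB hB' hvpos hBv hw
  refine ⟨w, hwpos, ?_, hBw⟩
  refine tendsto_nhds_unique (((continuous_maxMulVec A).tendsto w).comp hw) ?_
  convert hw using 2 with k
  change maxMulVec A ((maxMulVec B)^[k] v) = _
  rw [hcomm.iterate_right k v, hAv]

/-! ### Perron root and normalization -/

theorem cycleMean_pow (A : Matrix (Fin n) (Fin n) ℝ≥0) {k : ℕ} (c : Fin (k + 1) → Fin n) :
    cycleMean A c ^ (k + 1) = ∏ t, A (c t) (c (t + 1)) := by
  have := NNReal.rpow_inv_natCast_pow (∏ t, A (c t) (c (t + 1))) k.succ_ne_zero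
  simpa [cycleMean] using this

theorem cycleMean_le_perronRoot (A : Matrix (Fin n) (Fin n) ℝ≥0) {k : ℕ} (hk : k < n)
    (c : Fin (k + 1) → Fin n) : cycleMean A c ≤ perronRoot A :=
  (Finset.le_sup (f := fun c => cycleMean A c) (Finset.mem_univ c)).trans
    (Finset.le_sup (f := fun k => Finset.univ.sup fun c : Fin (k + 1) → Fin n => cycleMean A c)
      (Finset.mem_range.2 hk))

theorem exists_cycleMean_eq_perronRoot (hn : 1 ≤ n) (A : Matrix (Fin n) (Fin n) ℝ≥0) :
    ∃ (k : ℕ) (c : Fin (k + 1) → Fin n), cycleMean A c = perronRoot A := by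
  have : Nonempty (Fin n) := ⟨⟨0, hn⟩⟩
  obtain ⟨k, -, hk⟩ := Finset.exists_mem_eq_sup (Finset.range n) (by simp; omega)
    fun k => Finset.univ.sup fun c : Fin (k + 1) → Fin n => cycleMean A c
  obtain ⟨c, -, hc⟩ := Finset.exists_mem_eq_sup (Finset.univ : Finset (Fin (k + 1) → Fin n))
    Finset.univ_nonempty fun c => cycleMean A c
  exact ⟨k, c, by rw [perronRoot, hk, hc]⟩

theorem IsIrreducible.perronRoot_pos {A : Matrix (Fin n) (Fin n) ℝ≥0} (hn : 1 ≤ n)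
    (hA : IsIrreducible A) : 0 < perronRoot A := by
  obtain ⟨k, c, hc, -, hpos⟩ := exists_cycle_of_transGen (hA.transGen ⟨0, hn⟩ ⟨0, hn⟩)
  have hk : k + 1 ≤ n := by simpa using Fintype.card_le_of_injective c hc
  refine lt_of_lt_of_le ?_ (cycleMean_le_perronRoot A hk c)
  exact NNReal.rpow_pos (Finset.prod_pos fun t _ => hpos t)

theorem isDefinite_normalize {A : Matrix (Fin n) (Fin n) ℝ≥0} (hn : 1 ≤ n)
    (hA : 0 < perronRoot A) : IsDefinite ((perronRoot A)⁻¹ • A) := by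
  have hprod : ∀ {k : ℕ} (c : Fin (k + 1) → Fin n),
      ∏ t, ((perronRoot A)⁻¹ • A) (c t) (c (t + 1)) =
        ((perronRoot A)⁻¹ * cycleMean A c) ^ (k + 1) := by
    intro k c
    simp [Finset.prod_mul_distrib, mul_pow, cycleMean_pow]
  constructor
  · intro k hk c
    rw [hprod]
    refine pow_le_one₀ zero_le ?_
    rw [inv_mul_le_iff₀ hA, mul_one]
    exact cycleMean_le_perronRoot A hk c
  · obtain ⟨k, c, hc⟩ := exists_cycleMean_eq_perronRoot hn A
    exact ⟨k, c, by rw [hprod, hc, inv_mul_cancel₀ hA.ne', one_pow]⟩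

theorem MaxCommute.smul {A B : Matrix (Fin n) (Fin n) ℝ≥0} (h : MaxCommute A B) (a b : ℝ≥0) :
    MaxCommute (a • A) (b • B) := by
  have key : ∀ (A B : Matrix (Fin n) (Fin n) ℝ≥0) (a b : ℝ≥0) (i j : Fin n),
      maxMul (a • A) (b • B) i j = a * b * maxMul A B i j := by
    intro A B a b i j
    simp only [maxMul, Matrix.smul_apply, smul_eq_mul, NNReal.mul_finset_sup]
    congr 1
    funext k
    ring
  ext i j
  rw [key, key, h, mul_comm a b]

/-- The saturation digraph of `A` with respect to the vector `w`. -/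
def Saturated (A : Matrix (Fin n) (Fin n) ℝ≥0) (w : Fin n → ℝ≥0) (i j : Fin n) : Prop :=
  A i j * w j = w i

theorem exists_saturated {A : Matrix (Fin n) (Fin n) ℝ≥0} {w : Fin n → ℝ≥0}
    (hA : maxMulVec A w = w) (i : Fin n) : ∃ j, Saturated A w i j :=
  (exists_maxMulVec_eq A w i).imp fun _ h => by rw [Saturated, ← h, hA]

/-- The given path shows `w i ≤ (A ⊗ B) i k * w k`. For an `l` attaining that product entry, the
bounds from the eigenvector equations are squeezed into equalities. -/
theorem Saturated.comm {A B : Matrix (Fin n) (Fin n) ℝ≥0} (hAB : MaxCommute A B)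
    {w : Fin n → ℝ≥0} (hw : ∀ i, 0 < w i) (hA : maxMulVec A w = w) (hB : maxMulVec B w = w)
    {i j k : Fin n} (hij : Saturated B w i j) (hjk : Saturated A w j k) :
    ∃ l, Saturated A w i l ∧ Saturated B w l k := by
  have h1 : w i ≤ maxMul A B i k * w k := by
    rw [hAB, ← hij, ← hjk, ← mul_assoc]
    exact mul_le_mul_left
      (Finset.le_sup (f := fun l => B i l * A l k) (Finset.mem_univ j)) _
  obtain ⟨l, -, hl⟩ := Finset.exists_mem_eq_sup Finset.univ ⟨i, Finset.mem_univ i⟩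
    fun l => A i l * B l k
  rw [show maxMul A B i k = A i l * B l k from hl, mul_assoc] at h1
  have h2 : B l k * w k ≤ w l := (mul_le_maxMulVec B w l k).trans_eq (congrFun hB l)
  have h3 : A i l * w l ≤ w i := (mul_le_maxMulVec A w i l).trans_eq (congrFun hA i)
  have h4 : A i l * w l = w i := le_antisymm h3 (h1.trans (mul_le_mul_right h2 _))
  have h5 : 0 < A i l := pos_iff_ne_zero.2 fun h => by
    rw [h, zero_mul] at h4
    exact (hw i).ne h4
  exact ⟨l, h4, le_antisymm h2 (le_of_mul_le_mul_left (h4.trans_le h1) h5)⟩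

/-- Cycles of the saturation digraph of the normalized matrix are critical. -/
theorem isCriticalCycle_of_saturated {A : Matrix (Fin n) (Fin n) ℝ≥0} (hA : 0 < perronRoot A)
    {w : Fin n → ℝ≥0} (hw : ∀ i, 0 < w i) {k : ℕ} {c : Fin (k + 1) → Fin n}
    (hc : Function.Injective c)
    (hsat : ∀ t, Saturated ((perronRoot A)⁻¹ • A) w (c t) (c (t + 1))) :
    IsCriticalCycle A c := by
  have hsat' : ∀ t, A (c t) (c (t + 1)) * w (c (t + 1)) = perronRoot A * w (c t) := fun t => by
    rw [← hsat t, Matrix.smul_apply, smul_eq_mul, ← mul_assoc, mul_inv_cancel_left₀ hA.ne']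
  refine ⟨⟨hc, fun t => pos_iff_ne_zero.2 fun h => ?_⟩, ?_⟩
  · have := hsat' t
    rw [h, zero_mul] at this
    exact (mul_pos hA (hw _)).ne this
  · have hprod := Finset.prod_congr (s₁ := Finset.univ) rfl fun t _ => hsat' t
    rw [Finset.prod_mul_distrib, Finset.prod_mul_distrib,
      prod_add_one fun t => w (c t)] at hprod
    have h2 := mul_right_cancel₀ (Finset.prod_pos fun t _ => hw (c t)).ne' hprod
    rw [← cycleMean_pow, Finset.prod_const, Finset.card_univ, Fintype.card_fin] at h2
    exact pow_left_injective k.succ_ne_zero h2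

theorem exists_crit_cycle_of_common_eigenvector {A B : Matrix (Fin n) (Fin n) ℝ≥0} (hn : 1 ≤ n)
    (hAB : MaxCommute A B) (hA : 0 < perronRoot A) (hB : 0 < perronRoot B)
    {w : Fin n → ℝ≥0} (hw : ∀ i, 0 < w i) (hAw : maxMulVec ((perronRoot A)⁻¹ • A) w = w)
    (hBw : maxMulVec ((perronRoot B)⁻¹ • B) w = w) :
    ∃ (k : ℕ) (c : Fin (k + 1) → Fin n), (crit A).IsCycle c ∧ ∀ t, c t ∈ (crit B).nodes := by
  have : Nonempty (Fin n) := ⟨⟨0, hn⟩⟩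
  obtain ⟨k, c, hc, hcA, hcB⟩ := exists_cycle_of_comm (exists_saturated hAw)
    (exists_saturated hBw) fun _ _ _ => Saturated.comm (hAB.smul _ _) hw hAw hBw
  refine ⟨k, c, ⟨hc, fun t =>
    ⟨k, c, isCriticalCycle_of_saturated hA hw hc hcA, t, rfl, rfl⟩⟩, fun t => ?_⟩
  obtain ⟨l, d, hd, hd0, hdB⟩ := exists_cycle_of_transGen (hcB t)
  exact ⟨l, d, isCriticalCycle_of_saturated hB hw hd hdB, 0, hd0⟩

end MaxAlgebra

theorem theoremt (n : ℕ) (hn : 1 ≤ n) (A B : Matrix (Fin n) (Fin n) ℝ≥0)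
    (hA : MaxAlgebra.IsIrreducible A) (hB : MaxAlgebra.IsIrreducible B)
    (hAB : MaxAlgebra.MaxCommute A B) :
    (∃ (k : ℕ) (c₁ : Fin (k + 1) → Fin n), (MaxAlgebra.crit A).IsCycle c₁ ∧
      ∀ t, ∃ S, (MaxAlgebra.crit B).IsStrongComponent S ∧ c₁ t ∈ S) ∧
    (∃ (k : ℕ) (c₂ : Fin (k + 1) → Fin n), (MaxAlgebra.crit B).IsCycle c₂ ∧
      ∀ t, ∃ S, (MaxAlgebra.crit A).IsStrongComponent S ∧ c₂ t ∈ S) ∧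
    (∃ i : Fin n, i ∈ (MaxAlgebra.crit A).nodes ∧ i ∈ (MaxAlgebra.crit B).nodes) := by
  have hA₀ := hA.perronRoot_pos hn
  have hB₀ := hB.perronRoot_pos hn
  obtain ⟨w, hw, hAw, hBw⟩ := MaxAlgebra.exists_common_eigenvector (hAB.smul _ _)
    (MaxAlgebra.isDefinite_normalize hn hA₀) (MaxAlgebra.isDefinite_normalize hn hB₀)
    (fun i j => (hA.transGen i j).lift id fun _ _ h => mul_pos (inv_pos.2 hA₀) h)
    (fun i j => (hB.transGen i j).lift id fun _ _ h => mul_pos (inv_pos.2 hB₀) h)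
  obtain ⟨k, c, hc, hcB⟩ := MaxAlgebra.exists_crit_cycle_of_common_eigenvector hn hAB hA₀ hB₀
    hw hAw hBw
  obtain ⟨l, d, hd, hdA⟩ := MaxAlgebra.exists_crit_cycle_of_common_eigenvector hn hAB.symm hB₀ hA₀
    hw hBw hAw
  exact ⟨⟨k, c, hc, fun t => MaxAlgebra.NodeDigraph.exists_isStrongComponent (hcB t)⟩,
    ⟨l, d, hd, fun t => MaxAlgebra.NodeDigraph.exists_isStrongComponent (hdA t)⟩,
    c 0, ((MaxAlgebra.crit A).edge_mem (hc.2 0)).1, hcB 0⟩
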